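/- For $x>0$ with $x\neq\frac12$ let $$F(x)=\frac{\ln\Gamma(x+1)}{x\ln(2x)},$$ where $\Gamma(x)=\int_0^\infty t^{x-1}e^{-t}\,dt$ $(x>0)$ is Euler's gamma function. Then $F$ is strictly increasing on the interval $\bigl(0,\frac12\bigr)$, and on the interval $\bigl(\frac12,\infty\bigr)$ it is both strictly increasing and strictly concave. -/

import Mathlib

/-- The function `F(x) = ln Γ(x + 1) / (x ln (2 x))`, of interest for `x > 0` with `x ≠ 1 / 2`. -/
noncomputable def alzerF (x : ℝ) : ℝ :=
  Real.log (Real.Gamma (x + 1)) / (x * Real.log (2 * x))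

open Filter Topology Real Set

/-! Write G, D, T for log Γ(x + 1) and its first two derivatives, and L = log (2x). Differentiating
Euler's series termwise and telescoping give T ≤ 1/(x + 1/2). Integrating back from infinity, this
yields D ≥ log (x + 1/2) and then, by Stirling, a sharp upper bound for G.

On (0, 1/2) the numerator of F' is L(xD - G) - G; it is positive because xD - G ≤ x², -xL ≤ 1/5 and
G < -x/5.

On (1/2, ∞) the numerator of F'' increases in T and G and decreases in D, so all three bounds push
it up. What remains is a polynomial inequality in L and 2x = exp L (`alzer_polynomial_neg`), which
gives concavity. Since F ≥ 0 on [1, ∞), a strictly concave F must also increase. -/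

/-! ### Euler's series and its termwise derivatives -/

/-- The `k`-th term of Euler's series for `log Γ(x + 1)`. -/
noncomputable def eulerTerm (k : ℕ) (x : ℝ) : ℝ :=
  x * (log (k + 2) - log (k + 1)) - (log (x + k + 1) - log (k + 1))

noncomputable def eulerTermDeriv (k : ℕ) (x : ℝ) : ℝ :=
  (log (k + 2) - log (k + 1)) - 1 / (x + k + 1)

noncomputable def trigammaTerm (k : ℕ) (x : ℝ) : ℝ := 1 / (x + k + 1) ^ 2

/-- Euler's series for `log Γ(x + 1)`. -/
noncomputable def logGammaOneAdd (x : ℝ) : ℝ := ∑' k, eulerTerm k x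

/-- The series of the first derivative of `log Γ(x + 1)`. -/
noncomputable def digammaOneAdd (x : ℝ) : ℝ := ∑' k, eulerTermDeriv k x

/-- The series of the second derivative of `log Γ(x + 1)`. -/
noncomputable def trigammaOneAdd (x : ℝ) : ℝ := ∑' k, trigammaTerm k x

theorem add_nat_add_one_pos {x : ℝ} (hx : -(1 / 2) < x) (k : ℕ) : 0 < x + k + 1 := by
  have : (0 : ℝ) ≤ k := k.cast_nonneg
  linarith

theorem hasDerivAt_eulerTerm {x : ℝ} (hx : -(1 / 2) < x) (k : ℕ) :
    HasDerivAt (eulerTerm k) (eulerTermDeriv k x) x := by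
  have h := add_nat_add_one_pos hx k
  have h1 : HasDerivAt (fun y : ℝ => y + k + 1) 1 x := by
    simpa using ((hasDerivAt_id x).add_const (k : ℝ)).add_const 1
  have h2 := ((hasDerivAt_id x).mul_const (log (k + 2) - log (k + 1))).sub
    ((h1.log h.ne').sub_const (log (k + 1)))
  refine h2.congr_deriv ?_
  simp [eulerTermDeriv]

theorem hasDerivAt_eulerTermDeriv {x : ℝ} (hx : -(1 / 2) < x) (k : ℕ) :
    HasDerivAt (eulerTermDeriv k) (trigammaTerm k x) x := by
  have h := add_nat_add_one_pos hx k
  have h1 : HasDerivAt (fun y : ℝ => y + k + 1) 1 x := by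
    simpa using ((hasDerivAt_id x).add_const (k : ℝ)).add_const 1
  have h2 := (h1.inv h.ne').const_sub (log (k + 2) - log (k + 1))
  refine (h2.congr_deriv ?_).congr_of_eventuallyEq ?_
  · simp [trigammaTerm]; ring
  · filter_upwards with y
    simp [eulerTermDeriv]

theorem log_succ_sub_log_mem (k : ℕ) :
    1 / ((k : ℝ) + 2) ≤ log (k + 2) - log (k + 1) ∧
      log (k + 2) - log (k + 1) ≤ 1 / ((k : ℝ) + 1) := by
  have h1 : (0 : ℝ) < k + 1 := by positivity
  have h2 : (0 : ℝ) < k + 2 := by positivity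
  constructor
  · have := one_sub_inv_le_log_of_pos (div_pos h2 h1)
    rw [log_div h2.ne' h1.ne', inv_div] at this
    refine le_trans (le_of_eq ?_) this
    field_simp; ring
  · have := log_le_sub_one_of_pos (div_pos h2 h1)
    rw [log_div h2.ne' h1.ne'] at this
    refine this.trans (le_of_eq ?_)
    field_simp; ring

theorem summable_one_div_add_one_sq : Summable fun k : ℕ => 1 / ((k : ℝ) + 1) ^ 2 := by
  have h := (Real.summable_one_div_nat_pow (p := 2)).2 (by norm_num)
  simpa using (summable_nat_add_iff 1).2 h

theorem norm_eulerTermDeriv_le {R x : ℝ} (hx : x ∈ Ioo (-(1 / 2)) R) (k : ℕ) :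
    ‖eulerTermDeriv k x‖ ≤ (1 + 2 * (|R| + 1)) * (1 / ((k : ℝ) + 1) ^ 2) := by
  have h := add_nat_add_one_pos hx.1 k
  have hk : (0 : ℝ) ≤ k := k.cast_nonneg
  have h1 : (0 : ℝ) < k + 1 := by positivity
  obtain ⟨hl, hu⟩ := log_succ_sub_log_mem k
  have hxR : |x| ≤ |R| + 1 := by
    rw [abs_le]
    have := le_abs_self R
    have := abs_nonneg R
    exact ⟨by linarith [hx.1], by linarith [hx.2]⟩
  -- Both parts of the term are compared with 1/(k + 1), each with error O(1/(k + 1)²).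
  have e1 : |log (k + 2) - log (k + 1) - 1 / ((k : ℝ) + 1)| ≤ 1 / ((k : ℝ) + 1) ^ 2 := by
    have e : 1 / ((k : ℝ) + 1) - 1 / ((k : ℝ) + 2) ≤ 1 / ((k : ℝ) + 1) ^ 2 := by
      rw [div_sub_div _ _ (by positivity) (by positivity), div_le_div_iff₀ (by positivity)
        (by positivity)]
      nlinarith
    have : 0 < 1 / ((k : ℝ) + 1) ^ 2 := by positivity
    rw [abs_le]; constructor <;> linarith
  have e2 : |1 / ((k : ℝ) + 1) - 1 / (x + k + 1)| ≤ 2 * (|R| + 1) * (1 / ((k : ℝ) + 1) ^ 2) := by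
    have : 1 / ((k : ℝ) + 1) - 1 / (x + k + 1) = x * (1 / (((k : ℝ) + 1) * (x + k + 1))) := by
      field_simp; ring
    rw [this, abs_mul, abs_of_pos (a := 1 / (((k : ℝ) + 1) * (x + k + 1))) (by positivity)]
    have h3 : 1 / (((k : ℝ) + 1) * (x + k + 1)) ≤ 2 * (1 / ((k : ℝ) + 1) ^ 2) := by
      rw [mul_one_div, div_le_div_iff₀ (by positivity) (by positivity)]
      nlinarith [hx.1]
    calc |x| * (1 / (((k : ℝ) + 1) * (x + k + 1)))
        ≤ (|R| + 1) * (2 * (1 / ((k : ℝ) + 1) ^ 2)) := by gcongr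
      _ = _ := by ring
  have := abs_add_le (log (k + 2) - log (k + 1) - 1 / ((k : ℝ) + 1))
    (1 / ((k : ℝ) + 1) - 1 / (x + k + 1))
  rw [sub_add_sub_cancel] at this
  rw [norm_eq_abs, eulerTermDeriv]
  linarith

theorem norm_trigammaTerm_le {x : ℝ} (hx : -(1 / 2) < x) (k : ℕ) :
    ‖trigammaTerm k x‖ ≤ 4 * (1 / ((k : ℝ) + 1) ^ 2) := by
  have h := add_nat_add_one_pos hx k
  have hk : (0 : ℝ) ≤ k := k.cast_nonneg
  rw [norm_eq_abs, trigammaTerm, abs_of_pos (by positivity), mul_one_div,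
    div_le_div_iff₀ (by positivity) (by positivity)]
  nlinarith

theorem summable_eulerTermDeriv {x : ℝ} (hx : -(1 / 2) < x) :
    Summable fun k => eulerTermDeriv k x :=
  .of_norm_bounded (summable_one_div_add_one_sq.mul_left (1 + 2 * (|x + 1| + 1)))
    fun k => norm_eulerTermDeriv_le ⟨hx, by linarith⟩ k

theorem eulerTerm_zero (k : ℕ) : eulerTerm k 0 = 0 := by simp [eulerTerm]

theorem logGammaOneAdd_zero : logGammaOneAdd 0 = 0 := by simp [logGammaOneAdd, eulerTerm_zero]

theorem summable_eulerTerm {x : ℝ} (hx : -(1 / 2) < x) : Summable fun k => eulerTerm k x := by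
  have h0 : (0 : ℝ) ∈ Ioo (-(1 / 2) : ℝ) (|x| + 1) := ⟨by norm_num, by positivity⟩
  have hx' : x ∈ Ioo (-(1 / 2) : ℝ) (|x| + 1) := ⟨hx, by linarith [le_abs_self x]⟩
  exact summable_of_summable_hasDerivAt_of_isPreconnected
    (summable_one_div_add_one_sq.mul_left _) isOpen_Ioo isPreconnected_Ioo
    (fun k y hy => hasDerivAt_eulerTerm hy.1 k) (fun k y hy => norm_eulerTermDeriv_le hy k) h0
    (by simp [eulerTerm_zero]) hx'

theorem hasDerivAt_logGammaOneAdd {x : ℝ} (hx : -(1 / 2) < x) :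
    HasDerivAt logGammaOneAdd (digammaOneAdd x) x := by
  have hx' : x ∈ Ioo (-(1 / 2) : ℝ) (x + 1) := ⟨hx, by linarith⟩
  exact hasDerivAt_tsum_of_isPreconnected
    (summable_one_div_add_one_sq.mul_left _) isOpen_Ioo isPreconnected_Ioo
    (fun k y hy => hasDerivAt_eulerTerm hy.1 k) (fun k y hy => norm_eulerTermDeriv_le hy k) hx'
    (summable_eulerTerm hx) hx'

theorem hasDerivAt_digammaOneAdd {x : ℝ} (hx : -(1 / 2) < x) :
    HasDerivAt digammaOneAdd (trigammaOneAdd x) x :=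
  hasDerivAt_tsum_of_isPreconnected
    (summable_one_div_add_one_sq.mul_left 4) isOpen_Ioi isPreconnected_Ioi
    (fun k _ hy => hasDerivAt_eulerTermDeriv hy k) (fun k _ hy => norm_trigammaTerm_le hy k)
    (mem_Ioi.2 hx) (summable_eulerTermDeriv hx) (mem_Ioi.2 hx)

/-- `logGammaSeq` also contains the factor x of the Gamma product, hence the `log x`; the last
summand tends to 0. -/
theorem sum_range_eulerTerm (x : ℝ) (n : ℕ) :
    ∑ k ∈ Finset.range n, eulerTerm k x =
      BohrMollerup.logGammaSeq x n + log x + x * (log (n + 1) - log n) := by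
  have h : ∑ k ∈ Finset.range n, eulerTerm k x =
      x * log (n + 1) + log n.factorial - ∑ k ∈ Finset.range n, log (x + k + 1) := by
    induction n with
    | zero => simp
    | succ n ih =>
      rw [Finset.sum_range_succ, ih, Finset.sum_range_succ, Nat.factorial_succ, Nat.cast_mul,
        log_mul (by positivity) (by positivity), eulerTerm]
      push_cast
      rw [show (n : ℝ) + 1 + 1 = n + 2 by ring]
      ring
  rw [h, BohrMollerup.logGammaSeq, Finset.sum_range_succ']
  simp only [Nat.cast_add, Nat.cast_one, Nat.cast_zero, add_zero, ← add_assoc]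
  ring

theorem logGammaOneAdd_eq {x : ℝ} (hx : 0 < x) : logGammaOneAdd x = log (Gamma (x + 1)) := by
  have h1 := (summable_eulerTerm (by linarith : -(1 / 2) < x)).hasSum.tendsto_sum_nat
  have h2 : Tendsto (fun n : ℕ => ∑ k ∈ Finset.range n, eulerTerm k x) atTop
      (𝓝 (log (Gamma x) + log x + x * 0)) := by
    simp only [sum_range_eulerTerm]
    exact ((BohrMollerup.tendsto_log_gamma hx).add_const _).add
      (tendsto_log_nat_add_one_sub_log.const_mul x)
  rw [Gamma_add_one hx.ne', log_mul hx.ne' (Gamma_pos_of_pos hx).ne']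
  refine (tendsto_nhds_unique h1 h2).trans (by ring)

/-! ### Bounds for log Γ and its derivatives -/

theorem trigammaOneAdd_nonneg (x : ℝ) : 0 ≤ trigammaOneAdd x :=
  tsum_nonneg fun k => by rw [trigammaTerm]; positivity

theorem trigammaOneAdd_le {x : ℝ} (hx : -(1 / 2) < x) : trigammaOneAdd x ≤ 1 / (x + 1 / 2) := by
  have h (n : ℕ) : ∑ k ∈ Finset.range n, trigammaTerm k x ≤
      1 / (x + 1 / 2) - 1 / (x + n + 1 / 2) := by
    induction n with
    | zero => simp
    | succ n ih =>
      rw [Finset.sum_range_succ]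
      have h0 : (0 : ℝ) ≤ n := n.cast_nonneg
      have h1 : 0 < x + n + 1 / 2 := by linarith
      have h2 : 0 < x + n + 1 := by linarith
      have h3 : 0 < x + (n + 1) + 1 / 2 := by linarith
      -- With a = x + n + 1 this is 1/a² ≤ 1/(a² - 1/4).
      have : trigammaTerm n x ≤ 1 / (x + n + 1 / 2) - 1 / (x + (n + 1) + 1 / 2) := by
        rw [trigammaTerm, div_sub_div _ _ h1.ne' h3.ne', div_le_div_iff₀ (by positivity)
          (by positivity)]
        nlinarith
      push_cast
      linarith
  refine Real.tsum_le_of_sum_range_le (fun k => by rw [trigammaTerm]; positivity) fun n => ?_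
  have h0 : (0 : ℝ) ≤ n := n.cast_nonneg
  have h1 : 0 < 1 / (x + n + 1 / 2) := by
    have : 0 < x + n + 1 / 2 := by linarith
    positivity
  linarith [h n]

theorem monotoneOn_digammaOneAdd : MonotoneOn digammaOneAdd (Ioi (-(1 / 2))) := by
  refine monotoneOn_of_deriv_nonneg (convex_Ioi _)
    (fun x hx => (hasDerivAt_digammaOneAdd hx).continuousAt.continuousWithinAt) ?_ ?_
  · rw [interior_Ioi]
    exact fun x hx => (hasDerivAt_digammaOneAdd hx).differentiableAt.differentiableWithinAt
  · rw [interior_Ioi]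
    exact fun x hx => (hasDerivAt_digammaOneAdd hx).deriv ▸ trigammaOneAdd_nonneg x

theorem logGammaOneAdd_add_one {x : ℝ} (hx : 0 < x) :
    logGammaOneAdd (x + 1) = logGammaOneAdd x + log (x + 1) := by
  rw [logGammaOneAdd_eq hx, logGammaOneAdd_eq (by linarith), Gamma_add_one (by linarith : x + 1 ≠ 0),
    log_mul (by linarith) (Gamma_pos_of_pos (by linarith)).ne', add_comm]

/-- The functional equation makes `log x` the slope of log Γ(· + 1) over [x - 1, x], a value of the
monotone derivative. This crude bound controls the sharper one at infinity. -/
theorem log_le_digammaOneAdd {x : ℝ} (hx : 1 < x) : log x ≤ digammaOneAdd x := by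
  obtain ⟨c, hc, hc'⟩ := exists_hasDerivAt_eq_slope logGammaOneAdd digammaOneAdd
    (sub_one_lt x)
    (fun y hy => (hasDerivAt_logGammaOneAdd
      (by linarith [hy.1] : -(1 / 2) < y)).continuousAt.continuousWithinAt)
    (fun y hy => hasDerivAt_logGammaOneAdd (by linarith [hy.1]))
  have h := logGammaOneAdd_add_one (by linarith : 0 < x - 1)
  rw [sub_add_cancel] at h
  rw [h, sub_sub_cancel, div_one, add_sub_cancel_left] at hc'
  rw [← hc']
  exact monotoneOn_digammaOneAdd (mem_Ioi.2 (by linarith [hc.1])) (mem_Ioi.2 (by linarith)) hc.2.le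

theorem hasDerivAt_add_half (x : ℝ) : HasDerivAt (fun y : ℝ => y + 1 / 2) 1 x :=
  (hasDerivAt_id x).add_const _

theorem antitoneOn_digammaOneAdd_sub_log :
    AntitoneOn (fun x => digammaOneAdd x - log (x + 1 / 2)) (Ioi (-(1 / 2))) := by
  have hd (x : ℝ) (hx : x ∈ Ioi (-(1 / 2) : ℝ)) :
      HasDerivAt (fun x => digammaOneAdd x - log (x + 1 / 2))
        (trigammaOneAdd x - 1 / (x + 1 / 2)) x :=
    (hasDerivAt_digammaOneAdd hx).sub
      ((hasDerivAt_add_half x).log (by linarith [mem_Ioi.1 hx]))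
  refine antitoneOn_of_deriv_nonpos (convex_Ioi _)
    (fun x hx => (hd x hx).continuousAt.continuousWithinAt) ?_ ?_
  · rw [interior_Ioi]
    exact fun x hx => (hd x hx).differentiableAt.differentiableWithinAt
  · rw [interior_Ioi]
    intro x hx
    rw [(hd x hx).deriv]
    linarith [trigammaOneAdd_le hx]

theorem log_add_half_le_digammaOneAdd {x : ℝ} (hx : -(1 / 2) < x) :
    log (x + 1 / 2) ≤ digammaOneAdd x := by
  have hlim : Tendsto (fun y : ℝ => -(1 / 2) * y⁻¹) atTop (𝓝 (-(1 / 2) * 0)) :=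
    tendsto_inv_atTop_zero.const_mul _
  have : -(1 / 2) * 0 ≤ digammaOneAdd x - log (x + 1 / 2) := by
    refine le_of_tendsto hlim ?_
    filter_upwards [eventually_gt_atTop 1, eventually_ge_atTop x] with y hy hxy
    have h1 := antitoneOn_digammaOneAdd_sub_log hx (mem_Ioi.2 (by linarith)) hxy
    have h2 := log_le_digammaOneAdd hy
    have h3 := log_le_sub_one_of_pos (by positivity : 0 < (y + 1 / 2) / y)
    rw [log_div (by positivity) (by positivity)] at h3
    have h4 : (y + 1 / 2) / y - 1 = 1 / 2 * y⁻¹ := by field_simp; ring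
    dsimp only at h1
    linarith
  linarith

theorem antitoneOn_stirling_sub_logGammaOneAdd :
    AntitoneOn (fun x => (x + 1 / 2) * log (x + 1 / 2) - (x + 1 / 2) - logGammaOneAdd x)
      (Ioi (-(1 / 2))) := by
  have hd (x : ℝ) (hx : x ∈ Ioi (-(1 / 2) : ℝ)) :
      HasDerivAt (fun x => (x + 1 / 2) * log (x + 1 / 2) - (x + 1 / 2) - logGammaOneAdd x)
        (log (x + 1 / 2) - digammaOneAdd x) x := by
    have h0 : x + 1 / 2 ≠ 0 := by linarith [mem_Ioi.1 hx]
    have h := hasDerivAt_add_half x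
    refine (((h.mul (h.log h0)).sub h).sub (hasDerivAt_logGammaOneAdd hx)).congr_deriv ?_
    linear_combination mul_one_div_cancel h0
  refine antitoneOn_of_deriv_nonpos (convex_Ioi _)
    (fun x hx => (hd x hx).continuousAt.continuousWithinAt) ?_ ?_
  · rw [interior_Ioi]
    exact fun x hx => (hd x hx).differentiableAt.differentiableWithinAt
  · rw [interior_Ioi]
    intro x hx
    rw [(hd x hx).deriv]
    linarith [log_add_half_le_digammaOneAdd hx]

theorem logGammaOneAdd_le {x : ℝ} (hx : -(1 / 2) < x) :
    logGammaOneAdd x ≤ (x + 1 / 2) * log (x + 1 / 2) - (x + 1 / 2) + log (2 * π) / 2 := by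
  have hpi : (0 : ℝ) < √π := sqrt_pos.2 pi_pos
  have hlim : Tendsto (fun n : ℕ => -log (Stirling.stirlingSeq n)) atTop (𝓝 (-log √π)) :=
    (Stirling.tendsto_stirlingSeq_sqrt_pi.log hpi.ne').neg
  have : -log √π ≤ (x + 1 / 2) * log (x + 1 / 2) - (x + 1 / 2) - logGammaOneAdd x +
      log 2 / 2 := by
    refine le_of_tendsto hlim ?_
    filter_upwards [eventually_gt_atTop 0,
      tendsto_natCast_atTop_atTop.eventually_ge_atTop x] with n hn hxn
    have hn' : (0 : ℝ) < n := by exact_mod_cast hn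
    have h1 := antitoneOn_stirling_sub_logGammaOneAdd hx (mem_Ioi.2 (by linarith)) hxn
    have h2 := Stirling.log_stirlingSeq_formula n
    have h3 : logGammaOneAdd n = log n.factorial := by
      rw [logGammaOneAdd_eq hn', Gamma_nat_eq_factorial]
    rw [log_mul two_ne_zero hn'.ne', log_div hn'.ne' (exp_pos 1).ne', log_exp] at h2
    have h4 := one_sub_inv_le_log_of_pos (by positivity : 0 < ((n : ℝ) + 1 / 2) / n)
    rw [log_div (by positivity) (by positivity)] at h4
    have h5 : 1 / 2 ≤ ((n : ℝ) + 1 / 2) * (log (n + 1 / 2) - log n) := by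
      refine le_trans (le_of_eq ?_) (mul_le_mul_of_nonneg_left h4 (by positivity))
      field_simp
      ring
    dsimp only at h1
    rw [h3] at h1
    linarith
  rw [log_mul two_ne_zero pi_pos.ne']
  rw [log_sqrt pi_pos.le] at this
  linarith

/-! ### The derivatives of F -/

theorem eqOn_alzerF :
    EqOn alzerF (fun x => logGammaOneAdd x / (x * log (2 * x))) (Ioi 0) := fun x hx => by
  simp only [alzerF, logGammaOneAdd_eq hx]

theorem hasDerivAt_log_two_mul {x : ℝ} (hx : 0 < x) :
    HasDerivAt (fun y : ℝ => log (2 * y)) (1 / x) x := by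
  have h := ((hasDerivAt_id x).const_mul 2).log (by simpa using hx.ne')
  refine h.congr_deriv ?_
  simp only [id]
  field_simp

theorem hasDerivAt_mul_log_two_mul {x : ℝ} (hx : 0 < x) :
    HasDerivAt (fun y : ℝ => y * log (2 * y)) (log (2 * x) + 1) x := by
  refine ((hasDerivAt_id x).mul (hasDerivAt_log_two_mul hx)).congr_deriv ?_
  simp only [id]
  field_simp

/-- The numerator of the derivative of `alzerF`. -/
noncomputable def alzerDerivNum (x : ℝ) : ℝ :=
  log (2 * x) * (x * digammaOneAdd x - logGammaOneAdd x) - logGammaOneAdd x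

/-- The numerator of the second derivative of `alzerF`. -/
noncomputable def alzerDerivTwoNum (x : ℝ) : ℝ :=
  log (2 * x) ^ 2 * (x ^ 2 * trigammaOneAdd x)
    - 2 * log (2 * x) * (log (2 * x) + 1) * (x * digammaOneAdd x)
    + (2 * log (2 * x) ^ 2 + 3 * log (2 * x) + 2) * logGammaOneAdd x

theorem hasDerivAt_alzerF {x : ℝ} (hx : 0 < x) (hL : log (2 * x) ≠ 0) :
    HasDerivAt alzerF (alzerDerivNum x / (x * log (2 * x)) ^ 2) x := by
  have h := (hasDerivAt_logGammaOneAdd (by linarith : -(1 / 2) < x)).div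
    (hasDerivAt_mul_log_two_mul hx) (mul_ne_zero hx.ne' hL)
  refine (h.congr_deriv ?_).congr_of_eventuallyEq
    (eqOn_alzerF.eventuallyEq_of_mem (Ioi_mem_nhds hx))
  rw [alzerDerivNum]
  ring

theorem hasDerivAt_alzerDerivNum {x : ℝ} (hx : 0 < x) :
    HasDerivAt alzerDerivNum
      (x * log (2 * x) * trigammaOneAdd x - logGammaOneAdd x / x) x := by
  have hx' : -(1 / 2) < x := by linarith
  have h0 := hasDerivAt_logGammaOneAdd hx'
  have h := ((hasDerivAt_log_two_mul hx).mul
    (((hasDerivAt_id x).mul (hasDerivAt_digammaOneAdd hx')).sub h0)).sub h0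
  refine h.congr_deriv ?_
  simp only [id, Pi.mul_apply, Pi.sub_apply]
  field_simp
  ring

theorem hasDerivAt_alzerDerivNum_div {x : ℝ} (hx : 0 < x) (hL : log (2 * x) ≠ 0) :
    HasDerivAt (fun x => alzerDerivNum x / (x * log (2 * x)) ^ 2)
      (alzerDerivTwoNum x / (x * log (2 * x)) ^ 3) x := by
  have h := (hasDerivAt_alzerDerivNum hx).div ((hasDerivAt_mul_log_two_mul hx).pow 2)
    (pow_ne_zero 2 (mul_ne_zero hx.ne' hL))
  refine h.congr_deriv ?_
  simp only [Pi.pow_apply]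
  rw [alzerDerivTwoNum, alzerDerivNum]
  generalize log (2 * x) = L at *
  field_simp
  ring

/-! ### Monotonicity on (0, 1/2) -/

theorem mul_digammaOneAdd_sub_logGammaOneAdd_le {x : ℝ} (hx : 0 ≤ x) :
    x * digammaOneAdd x - logGammaOneAdd x ≤ x ^ 2 := by
  have hd (y : ℝ) (hy : 0 ≤ y) :
      HasDerivAt (fun x => x ^ 2 - (x * digammaOneAdd x - logGammaOneAdd x))
        (y * (2 - trigammaOneAdd y)) y := by
    have hy' : -(1 / 2) < y := by linarith
    refine (((hasDerivAt_id y).pow 2).sub (((hasDerivAt_id y).mul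
      (hasDerivAt_digammaOneAdd hy')).sub (hasDerivAt_logGammaOneAdd hy'))).congr_deriv ?_
    simp only [id]
    ring
  have hmono : MonotoneOn (fun x => x ^ 2 - (x * digammaOneAdd x - logGammaOneAdd x))
      (Ici (0 : ℝ)) := by
    refine monotoneOn_of_deriv_nonneg (convex_Ici _)
      (fun y hy => (hd y hy).continuousAt.continuousWithinAt) ?_ ?_
    · rw [interior_Ici]
      exact fun y hy => (hd y (mem_Ioi.1 hy).le).differentiableAt.differentiableWithinAt
    · rw [interior_Ici]
      intro y hy
      have hy0 : 0 < y := hy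
      rw [(hd y hy0.le).deriv]
      have h1 := trigammaOneAdd_le (by linarith : -(1 / 2) < y)
      have h2 : 1 / (y + 1 / 2) ≤ 2 := by
        rw [div_le_iff₀ (by positivity)]
        linarith
      exact mul_nonneg hy0.le (by linarith)
  have h := hmono self_mem_Ici hx hx
  simp only [logGammaOneAdd_zero] at h
  linarith

theorem convexOn_logGammaOneAdd : ConvexOn ℝ (Ioi (-(1 / 2))) logGammaOneAdd := by
  refine MonotoneOn.convexOn_of_deriv (convex_Ioi _)
    (fun x hx => (hasDerivAt_logGammaOneAdd hx).continuousAt.continuousWithinAt) ?_ ?_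
  · rw [interior_Ioi]
    exact fun x hx => (hasDerivAt_logGammaOneAdd hx).differentiableAt.differentiableWithinAt
  · rw [interior_Ioi]
    exact monotoneOn_digammaOneAdd.congr fun x hx => (hasDerivAt_logGammaOneAdd hx).deriv.symm

theorem logGammaOneAdd_half_lt : logGammaOneAdd (1 / 2) < -(1 / 10) := by
  rw [logGammaOneAdd_eq (by norm_num), Gamma_add_one (by norm_num), Gamma_one_half_eq,
    log_mul (by norm_num) (sqrt_pos.2 pi_pos).ne', log_sqrt pi_pos.le]
  have h1 := log_le_sub_one_of_pos (by positivity : 0 < π / 4)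
  rw [log_div pi_pos.ne' (by norm_num), show (4 : ℝ) = 2 ^ 2 by norm_num, log_pow] at h1
  rw [one_div, log_inv]
  push_cast at h1
  linarith [pi_lt_d2]

/-- By convexity the graph lies below its chord from 0 to 1/2. -/
theorem logGammaOneAdd_lt {x : ℝ} (hx : 0 < x) (hx' : x ≤ 1 / 2) :
    logGammaOneAdd x < -(1 / 5) * x := by
  have h := convexOn_logGammaOneAdd.2 (x := 0) (y := 1 / 2) (mem_Ioi.2 (by norm_num))
    (mem_Ioi.2 (by norm_num)) (by linarith : 0 ≤ 1 - 2 * x) (by linarith : 0 ≤ 2 * x) (by ring)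
  simp only [smul_eq_mul, logGammaOneAdd_zero, mul_zero, zero_add] at h
  rw [show 2 * x * (1 / 2) = x by ring] at h
  nlinarith [logGammaOneAdd_half_lt]

theorem neg_mul_log_two_mul_le {x : ℝ} (hx : 0 < x) : -(x * log (2 * x)) ≤ 1 / 5 := by
  -- The true maximum 1/(2e) is at 2x = 1/e; 2/5 is a rational slightly above 1/e.
  have h1 := one_sub_inv_le_log_of_pos (by positivity : 0 < 2 * x / (2 / 5))
  have h2 : log (2 / 5) > -1 := by
    rw [gt_iff_lt, lt_log_iff_exp_lt (by norm_num), exp_neg, inv_lt_comm₀ (exp_pos 1) (by norm_num)]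
    linarith [exp_one_gt_d9]
  rw [log_div (by positivity) (by norm_num)] at h1
  have h3 : x * (2 * x / (2 / 5))⁻¹ = 1 / 5 := by field_simp
  nlinarith

theorem alzerDerivNum_pos {x : ℝ} (hx : 0 < x) (hx' : x < 1 / 2) : 0 < alzerDerivNum x := by
  have h1 := mul_digammaOneAdd_sub_logGammaOneAdd_le hx.le
  have h2 := logGammaOneAdd_lt hx hx'.le
  have h3 := neg_mul_log_two_mul_le hx
  have h4 : log (2 * x) ≤ 0 := log_nonpos (by linarith) (by linarith)
  have h5 := mul_le_mul_of_nonpos_left h1 h4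
  rw [alzerDerivNum]
  nlinarith

theorem strictMonoOn_alzerF_left : StrictMonoOn alzerF (Ioo 0 (1 / 2)) := by
  have hL (x : ℝ) (hx : x ∈ Ioo (0 : ℝ) (1 / 2)) : log (2 * x) < 0 :=
    log_neg (by linarith [hx.1]) (by linarith [hx.2])
  have hd (x : ℝ) (hx : x ∈ Ioo (0 : ℝ) (1 / 2)) := hasDerivAt_alzerF hx.1 (hL x hx).ne
  refine strictMonoOn_of_deriv_pos (convex_Ioo _ _)
    (fun x hx => (hd x hx).continuousAt.continuousWithinAt) fun x hx => ?_
  rw [interior_Ioo] at hx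
  rw [(hd x hx).deriv]
  have := mul_neg_of_pos_of_neg hx.1 (hL x hx)
  exact div_pos (alzerDerivNum_pos hx.1 hx.2) (sq_pos_of_neg this)

/-! ### Concavity on (1/2, ∞) -/

theorem log_one_add_le_pade {t : ℝ} (ht : 0 ≤ t) :
    log (1 + t) ≤ t * (6 + t) / (6 + 4 * t) := by
  have hd (y : ℝ) (hy : 0 ≤ y) :
      HasDerivAt (fun t : ℝ => t * (6 + t) / (6 + 4 * t) - log (1 + t))
        (4 * y ^ 3 / ((6 + 4 * y) ^ 2 * (1 + y))) y := by
    have h1 : HasDerivAt (fun t : ℝ => 1 + t) 1 y := (hasDerivAt_id y).const_add 1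
    have h6 : HasDerivAt (fun t : ℝ => 6 + t) 1 y := (hasDerivAt_id y).const_add 6
    have h4 : HasDerivAt (fun t : ℝ => 6 + 4 * t) (4 * 1) y :=
      ((hasDerivAt_id y).const_mul 4).const_add 6
    have h := (((hasDerivAt_id y).mul h6).div h4 (by positivity)).sub (h1.log (by positivity))
    refine h.congr_deriv ?_
    simp only [id, Pi.mul_apply]
    field_simp
    ring
  have hmono : MonotoneOn (fun t : ℝ => t * (6 + t) / (6 + 4 * t) - log (1 + t))
      (Ici (0 : ℝ)) := by
    refine monotoneOn_of_deriv_nonneg (convex_Ici _)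
      (fun y hy => (hd y hy).continuousAt.continuousWithinAt) ?_ ?_
    · rw [interior_Ici]
      exact fun y hy => (hd y (mem_Ioi.1 hy).le).differentiableAt.differentiableWithinAt
    · rw [interior_Ici]
      intro y hy
      have hy0 : 0 < y := hy
      rw [(hd y hy0.le).deriv]
      positivity
  have h := hmono self_mem_Ici ht ht
  simp only [add_zero, log_one, mul_zero, zero_mul, zero_div, sub_zero] at h
  linarith

theorem log_two_mul_pi_lt : log (2 * π) < 1.849 := by
  have h1 := log_le_sub_one_of_pos (by positivity : 0 < π / exp 1)
  rw [log_div pi_pos.ne' (exp_pos 1).ne', log_exp] at h1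
  have h2 : π / exp 1 < 1.1558 := by
    rw [div_lt_iff₀ (exp_pos 1)]
    linarith [pi_lt_d4, exp_one_gt_d9]
  rw [log_mul two_ne_zero pi_pos.ne']
  linarith [log_two_lt_d9]

theorem cubic_le_exp {x : ℝ} (hx : 0 ≤ x) : 1 + x + x ^ 2 / 2 + x ^ 3 / 6 ≤ exp x := by
  have h := sum_le_exp_of_nonneg hx 4
  simpa [Finset.sum_range_succ, Nat.factorial] using h

/-- The polynomial inequality behind the concavity of `alzerF`, in `L = log (2 x)` and `u = 2 x`. -/
theorem alzer_polynomial_neg {L u : ℝ} (hL : 0 < L) (hu : 1 + L + L ^ 2 / 2 + L ^ 3 / 6 ≤ u) :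
    L ^ 2 * (u / 2 - 1 / 4) * (u * (6 * u + 4))
      + ((L - 0.6931) * (u * (6 * u + 4)) + (6 * u + 1)) *
        (L ^ 2 + 3 / 2 * L + 1 + u * (L + 2) / 2)
      - ((u + 1) / 2 - 0.9245) * (2 * L ^ 2 + 3 * L + 2) * (u * (6 * u + 4)) < 0 := by
  -- In terms of the slack s, the negated expression expands with only positive coefficients.
  obtain ⟨s, hs, rfl⟩ : ∃ s, 0 ≤ s ∧ u = 1 + L + L ^ 2 / 2 + L ^ 3 / 6 + s :=
    ⟨u - (1 + L + L ^ 2 / 2 + L ^ 3 / 6), by linarith, by ring⟩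
  rw [← neg_pos]
  ring_nf
  positivity

theorem alzerDerivTwoNum_neg {x : ℝ} (hx : 1 / 2 < x) : alzerDerivTwoNum x < 0 := by
  have hx' : -(1 / 2) < x := by linarith
  have hx0 : 0 < x := by linarith
  have hL : 0 < log (2 * x) := log_pos (by linarith)
  have h1 : x ^ 2 * trigammaOneAdd x ≤ x - 1 / 4 := by
    have h : x ^ 2 * trigammaOneAdd x ≤ x ^ 2 * (1 / (x + 1 / 2)) := by
      gcongr
      exact trigammaOneAdd_le hx'
    refine h.trans ?_
    rw [mul_one_div, div_le_iff₀ (by linarith)]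
    nlinarith
  have h2 := log_add_half_le_digammaOneAdd hx'
  have h3 := logGammaOneAdd_le hx'
  have h4 : log (x + 1 / 2) ≤
      log (2 * x) - 0.6931 + (6 * (2 * x) + 1) / (2 * x * (6 * (2 * x) + 4)) := by
    have h := log_one_add_le_pade (by positivity : 0 ≤ 1 / (2 * x))
    have e : x + 1 / 2 = 2 * x * (1 + 1 / (2 * x)) / 2 := by field_simp
    rw [e, log_div (by positivity) two_ne_zero, log_mul (by positivity) (by positivity)]
    have e2 : 1 / (2 * x) * (6 + 1 / (2 * x)) / (6 + 4 * (1 / (2 * x))) =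
        (6 * (2 * x) + 1) / (2 * x * (6 * (2 * x) + 4)) := by field_simp
    rw [e2] at h
    linarith [log_two_gt_d9]
  have h5 := log_two_mul_pi_lt
  have h6 : 1 + log (2 * x) + log (2 * x) ^ 2 / 2 + log (2 * x) ^ 3 / 6 ≤ 2 * x := by
    simpa [exp_log (by positivity : 0 < 2 * x)] using cubic_le_exp hL.le
  have key := alzer_polynomial_neg hL h6
  rw [alzerDerivTwoNum]
  generalize log (2 * x) = L at *
  generalize trigammaOneAdd x = T at *
  generalize digammaOneAdd x = D at *
  generalize logGammaOneAdd x = G at *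
  generalize log (x + 1 / 2) = M at *
  set q := 2 * x * (6 * (2 * x) + 4) with hq
  have hq0 : 0 < q := by positivity
  have s1 : L ^ 2 * (x ^ 2 * T) ≤ L ^ 2 * (x - 1 / 4) := by gcongr
  have s2 : 2 * L * (L + 1) * (x * M) ≤ 2 * L * (L + 1) * (x * D) := by gcongr
  have s3 : (2 * L ^ 2 + 3 * L + 2) * G ≤
      (2 * L ^ 2 + 3 * L + 2) * ((x + 1 / 2) * M - (x + 1 / 2) + 0.9245) := by
    gcongr
    linarith
  -- The coefficient is (2L² + 3L + 2)(x + 1/2) - 2L(L + 1)x: the terms in M from `s2` and `s3`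
  -- combined. Being positive, it lets M be replaced by its Padé bound.
  have s4 : (L ^ 2 + 3 / 2 * L + 1 + x * (L + 2)) * M ≤
      (L ^ 2 + 3 / 2 * L + 1 + x * (L + 2)) * (L - 0.6931 + (6 * (2 * x) + 1) / q) := by gcongr
  have s5 : L ^ 2 * (x - 1 / 4) +
      (L ^ 2 + 3 / 2 * L + 1 + x * (L + 2)) * (L - 0.6931 + (6 * (2 * x) + 1) / q)
      - (x + 1 / 2 - 0.9245) * (2 * L ^ 2 + 3 * L + 2) < 0 := by
    refine neg_of_mul_neg_left (b := q) ?_ hq0.le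
    refine lt_of_eq_of_lt ?_ key
    field_simp
  nlinarith

theorem log_two_mul_pos {x : ℝ} (hx : x ∈ Ioi (1 / 2 : ℝ)) : 0 < log (2 * x) :=
  log_pos (by linarith [mem_Ioi.1 hx])

theorem pos_of_mem_Ioi_half {x : ℝ} (hx : x ∈ Ioi (1 / 2 : ℝ)) : 0 < x := by
  linarith [mem_Ioi.1 hx]

theorem strictConcaveOn_alzerF : StrictConcaveOn ℝ (Ioi (1 / 2)) alzerF := by
  have hd (x : ℝ) (hx : x ∈ Ioi (1 / 2 : ℝ)) :=
    hasDerivAt_alzerF (pos_of_mem_Ioi_half hx) (log_two_mul_pos hx).ne'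
  refine strictConcaveOn_of_deriv2_neg' (convex_Ioi _)
    (fun x hx => (hd x hx).continuousAt.continuousWithinAt) fun x hx => ?_
  have he : deriv alzerF =ᶠ[𝓝 x] fun x => alzerDerivNum x / (x * log (2 * x)) ^ 2 := by
    filter_upwards [Ioi_mem_nhds hx] with y hy using (hd y hy).deriv
  have h0 := pos_of_mem_Ioi_half hx
  have hL := log_two_mul_pos hx
  rw [Function.iterate_succ, Function.iterate_one, Function.comp_apply, he.deriv_eq,
    (hasDerivAt_alzerDerivNum_div h0 hL.ne').deriv]
  exact div_neg_of_neg_of_pos (alzerDerivTwoNum_neg hx) (by positivity)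

/-! ### Monotonicity on (1/2, ∞) -/

theorem alzerF_nonneg {x : ℝ} (hx : 1 ≤ x) : 0 ≤ alzerF x := by
  have h1 : 0 ≤ logGammaOneAdd x := by
    -- 1 lies between 0 and x, and log Γ(· + 1) vanishes at 0 and 1.
    have h := convexOn_logGammaOneAdd.2 (x := 0) (y := x) (mem_Ioi.2 (by norm_num))
      (mem_Ioi.2 (by linarith)) (sub_nonneg.2 (inv_le_one_of_one_le₀ hx))
      (by positivity : 0 ≤ x⁻¹) (by ring)
    simp only [smul_eq_mul, logGammaOneAdd_zero, mul_zero, zero_add] at h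
    rw [inv_mul_cancel₀ (by positivity), logGammaOneAdd_eq one_pos] at h
    norm_num at h
    exact nonneg_of_mul_nonneg_right h (by positivity)
  rw [eqOn_alzerF (by linarith : 0 < x)]
  have := log_nonneg (by linarith : 1 ≤ 2 * x)
  positivity

/-- A strictly concave function on a half-line that is bounded below near infinity is strictly
increasing. -/
theorem StrictConcaveOn.strictMonoOn_of_eventually_ge {f : ℝ → ℝ} {a m : ℝ}
    (hf : StrictConcaveOn ℝ (Ioi a) f) (hm : ∀ᶠ x in atTop, m ≤ f x) :
    StrictMonoOn f (Ioi a) := by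
  intro x hx y hy hxy
  by_contra! hle
  obtain ⟨z, hyz⟩ : ∃ z, y < z := exists_gt y
  have hz : z ∈ Ioi a := lt_trans hy hyz
  have hs := hf.slope_anti_adjacent hx hz hxy hyz
  have hneg : (f z - f y) / (z - y) < 0 :=
    hs.trans_le (div_nonpos_of_nonpos_of_nonneg (by linarith) (by linarith))
  set c := (f z - f y) / (z - y) with hc
  -- Beyond z, concavity keeps f below this descending line, against the lower bound m.
  have hlim : Tendsto (fun w => f z + c * (w - z)) atTop atBot :=
    tendsto_atBot_add_const_left _ _ ((tendsto_atTop_add_const_right _ (-z)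
      tendsto_id).const_mul_atTop_of_neg hneg)
  obtain ⟨w, hw1, hw2, hzw⟩ :=
    (hm.and ((hlim.eventually_lt_atBot m).and (eventually_gt_atTop z))).exists
  have hw := hf.slope_anti_adjacent hy (lt_trans hz hzw) hyz hzw
  rw [← hc, div_lt_iff₀ (by linarith)] at hw
  linarith

theorem theorem1 :
    StrictMonoOn alzerF (Set.Ioo 0 (1 / 2)) ∧
      StrictMonoOn alzerF (Set.Ioi (1 / 2)) ∧
      StrictConcaveOn ℝ (Set.Ioi (1 / 2)) alzerF := by
  refine ⟨strictMonoOn_alzerF_left, ?_, strictConcaveOn_alzerF⟩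
  refine strictConcaveOn_alzerF.strictMonoOn_of_eventually_ge (m := 0) ?_
  filter_upwards [eventually_ge_atTop 1] with x hx using alzerF_nonneg hx
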